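/- Let $n\ge 3$, and let $D\subset\mathbb R^n$ be a bounded strongly convex domain with $\mathscr C^2$ boundary; that is, $D$ is a nonempty bounded convex open set such that every point $p\in\partial D$ has an open neighbourhood $U$ with a $\mathscr C^2$ function $h:U\to\mathbb R$ satisfying $dh\ne 0$ on $U$, $D\cap U=\{x\in U: h(x)<0\}$, and $\mathrm{Hess}_h(p)(v,v)>0$ for every nonzero vector $v\in\ker dh_p=T_p\partial D$. Let $\mathbb D=\{z=x+\mathrm i y\in\mathbb C:|z|<1\}$, and let $\mathrm{CH}(\mathbb D,D)$ denote the set of harmonic maps $f:\mathbb D\to D$ with $|f_x|=|f_y|$ and $f_x\cdot f_y=0$ at every point of $\mathbb D$. The minimal metric on $D$ is $$g_D(x,u)=\inf\{1/r : r>0,\ \exists f\in \mathrm{CH}(\mathbb D,D),\ f(0)=x,\ f_x(0)=ru\},\qquad x\in D,\ u\in\mathbb R^n,$$ and the minimal pseudodistance is $$\rho_D(x,y)=\inf_\gamma\int_0^1 g_D(\gamma(t),\dot\gamma(t))\,dt,\qquad x,y\in D,$$ where the infimum is over all piecewise smooth paths $\gamma:[0,1]\to D$ with $\gamma(0)=x$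 and $\gamma(1)=y$. Then $D$ is complete hyperbolic in the minimal metric: $\rho_D$ is a (finite-valued) distance function on $D$, and $(D,\rho_D)$ is a complete metric space. -/

import Mathlib

open Set Metric MeasureTheory
open scoped ENNReal ContDiff

/-- `f` restricts to a conformal harmonic map from the unit disc `{z : ℂ | |z| < 1}` to `D ⊆ ℝⁿ`,
where `z = x + i y`: it is harmonic and `|f_x| = |f_y|`, `f_x · f_y = 0` at every point of the
disc (points with `f_x = f_y = 0` are allowed). The values of `f` off the disc play no role. -/
structure IsConformalHarmonicDisc {n : ℕ} (D : Set (EuclideanSpace ℝ (Fin n)))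
    (f : ℂ → EuclideanSpace ℝ (Fin n)) : Prop where
  mapsTo : MapsTo f (ball (0 : ℂ) 1) D
  harmonic : InnerProductSpace.HarmonicOnNhd f (ball (0 : ℂ) 1)
  norm_eq : ∀ z ∈ ball (0 : ℂ) 1, ‖fderiv ℝ f z 1‖ = ‖fderiv ℝ f z Complex.I‖
  inner_eq_zero : ∀ z ∈ ball (0 : ℂ) 1, inner ℝ (fderiv ℝ f z 1) (fderiv ℝ f z Complex.I) = 0

/-- The minimal metric
`g_D(x, u) = inf {1/r : r > 0, ∃ f : 𝔻 → D conformal harmonic, f(0) = x, f_x(0) = r u}`. -/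
noncomputable def minimalMetric {n : ℕ} (D : Set (EuclideanSpace ℝ (Fin n)))
    (x u : EuclideanSpace ℝ (Fin n)) : ℝ≥0∞ :=
  ⨅ (r : ℝ) (_ : 0 < r)
    (_ : ∃ f : ℂ → EuclideanSpace ℝ (Fin n), IsConformalHarmonicDisc D f ∧ f 0 = x ∧
      fderiv ℝ f 0 1 = r • u), ENNReal.ofReal (1 / r)

/-- `γ` restricts to a piecewise smooth path `[0, 1] → D` from `x` to `y`: there is a partition
`0 = t₀ < t₁ < ⋯ < t_k = 1` such that `γ` is smooth (`C^∞`, up to the end points) on each closed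
interval `[t_{i}, t_{i+1}]`. -/
structure IsPiecewiseSmoothPath {n : ℕ} (D : Set (EuclideanSpace ℝ (Fin n)))
    (x y : EuclideanSpace ℝ (Fin n)) (γ : ℝ → EuclideanSpace ℝ (Fin n)) : Prop where
  mapsTo : MapsTo γ (Icc 0 1) D
  continuousOn : ContinuousOn γ (Icc 0 1)
  source : γ 0 = x
  target : γ 1 = y
  piecewise : ∃ (k : ℕ) (t : Fin (k + 1) → ℝ), StrictMono t ∧ t 0 = 0 ∧ t (Fin.last k) = 1 ∧
    ∀ i : Fin k, ContDiffOn ℝ ∞ γ (Icc (t i.castSucc) (t i.succ))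

/-- The minimal pseudodistance `ρ_D(x, y) = inf_γ ∫₀¹ g_D(γ(t), γ'(t)) dt` over all piecewise smooth
paths in `D` from `x` to `y`. (The finitely many points where `γ` is not differentiable form a
null set.) -/
noncomputable def minimalDistance {n : ℕ} (D : Set (EuclideanSpace ℝ (Fin n)))
    (x y : EuclideanSpace ℝ (Fin n)) : ℝ≥0∞ :=
  ⨅ (γ : ℝ → EuclideanSpace ℝ (Fin n)) (_ : IsPiecewiseSmoothPath D x y γ),
    ∫⁻ t in Icc (0 : ℝ) 1, minimalMetric D (γ t) (deriv γ t)

/-- `D` is complete hyperbolic: `ρ_D` is a (finite-valued) distance function on `D`, and the metric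
space `(D, ρ_D)` is complete. -/
def IsCompleteHyperbolic {n : ℕ} (D : Set (EuclideanSpace ℝ (Fin n))) : Prop :=
  ∃ m : MetricSpace D,
    (∀ x y : D, m.edist x y = minimalDistance D (x : EuclideanSpace ℝ (Fin n)) y) ∧
      @CompleteSpace D m.toPseudoMetricSpace.toUniformSpace

/-- `h` is a `C²` local defining function of `D` on the neighbourhood `U` of `p`. -/
structure IsC2DefiningFunctionAt {n : ℕ} (D : Set (EuclideanSpace ℝ (Fin n)))
    (p : EuclideanSpace ℝ (Fin n)) (U : Set (EuclideanSpace ℝ (Fin n)))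
    (h : EuclideanSpace ℝ (Fin n) → ℝ) : Prop where
  isOpen : IsOpen U
  mem : p ∈ U
  contDiffOn : ContDiffOn ℝ 2 h U
  fderiv_ne_zero : ∀ x ∈ U, fderiv ℝ h x ≠ 0
  inter_eq : D ∩ U = {x ∈ U | h x < 0}

/-- `D` is a strongly convex domain with `C²` boundary: a convex domain which near each boundary
point `p` has a `C²` defining function whose Hessian at `p` is positive definite on the tangent
space of `∂D` at `p`, that is, all principal curvatures of `∂D` are positive. -/
structure IsStronglyConvexC2Domain {n : ℕ} (D : Set (EuclideanSpace ℝ (Fin n))) : Prop where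
  isOpen : IsOpen D
  nonempty : D.Nonempty
  convex : Convex ℝ D
  hessian_pos : ∀ p ∈ frontier D, ∃ (U : Set (EuclideanSpace ℝ (Fin n)))
    (h : EuclideanSpace ℝ (Fin n) → ℝ), IsC2DefiningFunctionAt D p U h ∧
      ∀ v : EuclideanSpace ℝ (Fin n), v ≠ 0 → fderiv ℝ h p v = 0 →
        0 < fderiv ℝ (fderiv ℝ h) p v v

/-!
Lower bounds for `g_D` come from half spaces `{L < c}` containing `D`. If `f` is a harmonic disc in `D`, then
`c - L ∘ f` is a positive harmonic function on the disc, so Harnack's inequality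
(`abs_fderiv_zero_le_two_mul_of_harmonic_pos`, a consequence of the Schwarz lemma) gives
`|L u| / (c - L x) ≤ 2 g_D(x, u)` (`enorm_div_le_two_mul_minimalMetric`). Integrated along paths,
this says that `log (c - L)` is `2`-Lipschitz for `ρ_D` (`enorm_log_sub_log_le`).

Since `D` is bounded, it lies in such a half space in each direction `L`, and `ρ_D` dominates a
multiple of the Euclidean distance (`exists_edist_le_mul_minimalDistance`); hence `ρ_D` separates
points, and a `ρ_D`-Cauchy sequence has a Euclidean limit `q`. If `q` were not in `D`, a hyperplane
`{L = c}` through `q` would bound a half space containing `D`, and `log (c - L)` would be unbounded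
along the sequence, contrary to the Lipschitz estimate. So `q ∈ D`.

Conversely, flat conformal discs give `g_D(x, u) ≤ |u| / δ` whenever the ball of radius `δ` about
`x` lies in `D` (`minimalMetric_le_norm_div`; a vector orthogonal to `u` is needed here, whence
`n ≥ 2`). So `ρ_D` is finite on the convex set `D` and is locally dominated by the Euclidean
distance, which turns the Euclidean limit `q` into a `ρ_D`-limit. Symmetry and the triangle
inequality come from reversing and concatenating paths; they use that `g_D` is even and
homogeneous in `u`. The integrands need not be measurable, so only properties of the lower integral
valid for arbitrary functions are used.
-/

open Filter Topology InnerProductSpace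

variable {n : ℕ} {D : Set (EuclideanSpace ℝ (Fin n))} {x y z u : EuclideanSpace ℝ (Fin n)}

/-! ### Harmonic functions and conformal harmonic discs -/

/-- **Schwarz lemma for the right half plane.** With
`w₀ = F 0`, the Cayley transform `w ↦ (w - w₀) / (w + conj w₀)` sends the half plane into the disc
and `w₀` to `0`, and its derivative at `w₀` is `1 / (2 re w₀)`. -/
theorem norm_deriv_zero_le_two_mul_re {F : ℂ → ℂ} (hF : DifferentiableOn ℂ F (ball 0 1))
    (hpos : ∀ z ∈ ball (0 : ℂ) 1, 0 < (F z).re) : ‖deriv F 0‖ ≤ 2 * (F 0).re := by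
  have h0 : (0 : ℂ) ∈ ball (0 : ℂ) 1 := mem_ball_self one_pos
  set a : ℂ := starRingEnd ℂ (F 0) with ha
  have hre0 := hpos 0 h0
  have hden : ∀ z ∈ ball (0 : ℂ) 1, F z + a ≠ 0 := by
    intro z hz h
    have := congrArg Complex.re h
    have h1 := hpos z hz
    simp [ha] at this
    linarith
  have hG : DifferentiableOn ℂ (fun z ↦ (F z - F 0) / (F z + a)) (ball 0 1) :=
    (hF.sub_const _).div (hF.add_const _) hden
  have hmaps : MapsTo (fun z ↦ (F z - F 0) / (F z + a)) (ball 0 1)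
      (closedBall ((F 0 - F 0) / (F 0 + a)) 1) := by
    intro z hz
    have h1 := hpos z hz
    simp only [sub_self, zero_div, mem_closedBall, dist_zero_right, norm_div]
    refine div_le_one_of_le₀ ?_ (norm_nonneg _)
    rw [Complex.norm_def, Complex.norm_def]
    apply Real.sqrt_le_sqrt
    simp only [Complex.normSq_apply, Complex.sub_re, Complex.sub_im, Complex.add_re,
      Complex.add_im, ha, Complex.conj_re, Complex.conj_im]
    nlinarith [mul_pos h1 hre0]
  have hS := Complex.norm_deriv_le_div_of_mapsTo_ball hG hmaps one_pos
  have hd : HasDerivAt F (deriv F 0) 0 := (hF.differentiableAt (ball_mem_nhds _ one_pos)).hasDerivAt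
  have hGd := (hd.sub_const (F 0)).div (hd.add_const a) (hden 0 h0)
  have hFa : F 0 + a = ((2 * (F 0).re : ℝ) : ℂ) := by
    apply Complex.ext <;> simp [ha]; ring
  have hGd' : deriv (fun z ↦ (F z - F 0) / (F z + a)) 0 = deriv F 0 / (F 0 + a) := by
    have := hGd.deriv
    have h2 := hden 0 h0
    refine this.trans ?_
    field_simp
    ring
  rw [hGd', hFa, norm_div, Complex.norm_real, Real.norm_of_nonneg (by positivity), div_one,
    div_le_one (by positivity)] at hS
  exact hS

/-- The gradient form of **Harnack's inequality** at the centre of the unit disc. -/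
theorem abs_fderiv_zero_le_two_mul_of_harmonic_pos {h : ℂ → ℝ} (hh : HarmonicOnNhd h (ball 0 1))
    (hpos : ∀ z ∈ ball (0 : ℂ) 1, 0 < h z) : |fderiv ℝ h 0 1| ≤ 2 * h 0 := by
  obtain ⟨F, hFa, hFh⟩ := hh.exists_analyticOnNhd_ball_re_eq
  have h0 : (0 : ℂ) ∈ ball (0 : ℂ) 1 := mem_ball_self one_pos
  have hS := norm_deriv_zero_le_two_mul_re hFa.differentiableOn
    (fun z hz ↦ by rw [show (F z).re = h z from hFh hz]; exact hpos z hz)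
  have hd : HasDerivAt F (deriv F 0) 0 := (hFa 0 h0).differentiableAt.hasDerivAt
  have hd' := (Complex.reCLM.hasFDerivAt (x := F 0)).comp (0 : ℂ) (hd.hasFDerivAt.restrictScalars ℝ)
  have heq : h =ᶠ[𝓝 0] Complex.reCLM ∘ F :=
    (hFh.eventuallyEq_of_mem (ball_mem_nhds _ one_pos)).symm
  rw [heq.fderiv_eq, hd'.fderiv, ← hFh h0]
  refine le_trans ?_ hS
  simpa using Complex.abs_re_le_norm (deriv F 0)

theorem fderiv_fun_comp_neg {F : Type*} [NormedAddCommGroup F] [NormedSpace ℝ F] (f : ℂ → F)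
    (z : ℂ) : fderiv ℝ (fun z ↦ f (-z)) z = -fderiv ℝ f (-z) := by
  have := (ContinuousLinearEquiv.neg ℝ (M := ℂ)).comp_right_fderiv (f := f) (x := z)
  refine Eq.trans ?_ (this.trans ?_)
  · rfl
  · ext v
    all_goals simp

theorem HarmonicOnNhd.comp_neg_ball {f : ℂ → EuclideanSpace ℝ (Fin n)}
    (hf : HarmonicOnNhd f (ball 0 1)) : HarmonicOnNhd (fun z ↦ f (-z)) (ball 0 1) := by
  have hL : Laplacian.laplacian (fun z ↦ f (-z)) = fun z ↦ (Laplacian.laplacian f : ℂ → _) (-z) := by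
    have h1 : fderiv ℝ (fun z ↦ f (-z)) = fun z ↦ -fderiv ℝ f (-z) :=
      funext fun z ↦ fderiv_fun_comp_neg f z
    have h2 : fderiv ℝ (fderiv ℝ (fun z ↦ f (-z))) = fun z ↦ fderiv ℝ (fderiv ℝ f) (-z) := by
      rw [h1]
      ext1 z
      rw [fderiv_fun_neg, fderiv_fun_comp_neg, neg_neg]
    simp [laplacian_eq_iteratedFDeriv_complexPlane, iteratedFDeriv_two_apply, h2]
  intro z hz
  have hz' : -z ∈ ball (0 : ℂ) 1 := by simpa using hz
  refine ⟨(hf _ hz').1.comp z contDiff_neg.contDiffAt, ?_⟩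
  rw [hL]
  exact (continuous_neg.tendsto z).eventually (hf _ hz').2

theorem IsConformalHarmonicDisc.comp_neg {f : ℂ → EuclideanSpace ℝ (Fin n)}
    (hf : IsConformalHarmonicDisc D f) : IsConformalHarmonicDisc D (fun z ↦ f (-z)) where
  mapsTo z hz := hf.mapsTo (by simpa using hz)
  harmonic := HarmonicOnNhd.comp_neg_ball hf.harmonic
  norm_eq z hz := by
    simpa [fderiv_fun_comp_neg] using hf.norm_eq (-z) (by simpa using hz)
  inner_eq_zero z hz := by
    simpa [fderiv_fun_comp_neg] using hf.inner_eq_zero (-z) (by simpa using hz)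

/-- The flat disc `s + i t ↦ x + s a + t b` spanned by orthogonal vectors of equal length. -/
theorem isConformalHarmonicDisc_affine {a b : EuclideanSpace ℝ (Fin n)} (hab : ‖a‖ = ‖b‖)
    (horth : inner ℝ a b = 0) (hD : ball x ‖a‖ ⊆ D) (hx : x ∈ D) :
    IsConformalHarmonicDisc D (fun z : ℂ ↦ x + (z.re • a + z.im • b)) ∧
      fderiv ℝ (fun z : ℂ ↦ x + (z.re • a + z.im • b)) 0 1 = a := by
  set T : ℂ →L[ℝ] EuclideanSpace ℝ (Fin n) :=
    Complex.reCLM.smulRight a + Complex.imCLM.smulRight b with hT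
  have hTz : ∀ z, T z = z.re • a + z.im • b := fun z ↦ by simp [hT]
  simp_rw [← hTz]
  have hfd : fderiv ℝ (fun z ↦ x + T z) = fun _ ↦ T := by
    ext1 z
    rw [fderiv_const_add, T.fderiv]
  refine ⟨⟨?_, ?_, ?_, ?_⟩, ?_⟩
  · intro z hz
    have hz1 : ‖z‖ < 1 := by simpa using hz
    have hnorm : ‖T z‖ = ‖z‖ * ‖a‖ := by
      rw [← sq_eq_sq₀ (norm_nonneg _) (by positivity), hTz, norm_add_sq_real, inner_smul_left,
        inner_smul_right, horth, norm_smul, norm_smul, ← hab, mul_pow, mul_pow, mul_pow,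
        Complex.sq_norm, Complex.normSq_apply]
      simp
      ring
    rcases eq_or_ne a 0 with h | h
    · have : T z = 0 := by rw [← norm_eq_zero, hnorm, h]; simp
      simpa [this] using hx
    · apply hD
      have := norm_pos_iff.2 h
      simp only [mem_ball, dist_self_add_left, hnorm]
      nlinarith
  · intro z _
    refine ⟨by fun_prop, ?_⟩
    rw [laplacian_eq_iteratedFDeriv_complexPlane]
    refine .of_forall fun z ↦ ?_
    simp [iteratedFDeriv_two_apply, hfd]
  · intro z _; simp only [hfd]; simp [hTz, hab]
  · intro z _; simp only [hfd]; simpa [hTz] using horth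
  · simp only [hfd]; simp [hTz]

theorem exists_orthogonal_of_norm_eq (hn : 2 ≤ n) (a : EuclideanSpace ℝ (Fin n)) :
    ∃ b : EuclideanSpace ℝ (Fin n), ‖a‖ = ‖b‖ ∧ inner ℝ a b = 0 := by
  have hne : (Submodule.span ℝ {a})ᗮ ≠ ⊥ := by
    intro h
    have h1 := Submodule.finrank_add_finrank_orthogonal (Submodule.span ℝ {a})
    rw [h, finrank_bot, finrank_euclideanSpace_fin] at h1
    have := finrank_span_le_card (R := ℝ) ({a} : Set (EuclideanSpace ℝ (Fin n)))
    rw [Set.toFinset_card, Fintype.card_unique] at this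
    omega
  obtain ⟨e, he, he0⟩ := Submodule.exists_mem_ne_zero_of_ne_bot hne
  have hin : inner ℝ a e = 0 := (Submodule.mem_orthogonal_singleton_iff_inner_right).1 he
  refine ⟨(‖a‖ / ‖e‖) • e, ?_, by rw [inner_smul_right, hin, mul_zero]⟩
  have := norm_pos_iff.2 he0
  rw [norm_smul, norm_div, norm_norm, norm_norm]
  field_simp

/-! ### Estimates of the minimal metric -/

theorem minimalMetric_le_of_disc {f : ℂ → EuclideanSpace ℝ (Fin n)} {r : ℝ} (hr : 0 < r)
    (hf : IsConformalHarmonicDisc D f) (h0 : f 0 = x) (hd : fderiv ℝ f 0 1 = r • u) :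
    minimalMetric D x u ≤ ENNReal.ofReal (1 / r) :=
  iInf_le_of_le r (iInf_le_of_le hr (iInf_le_of_le ⟨f, hf, h0, hd⟩ le_rfl))

theorem minimalMetric_smul_le {c : ℝ} (hc : 0 < c) :
    minimalMetric D x (c • u) ≤ ENNReal.ofReal c * minimalMetric D x u := by
  rw [mul_comm, ← ENNReal.div_le_iff_le_mul (by simp [hc]) (by simp)]
  refine le_iInf fun r ↦ le_iInf fun hr ↦ le_iInf fun ⟨f, hf, h0, hd⟩ ↦ ?_
  rw [ENNReal.div_le_iff_le_mul (by simp [hc]) (by simp), mul_comm, ← ENNReal.ofReal_mul hc.le]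
  refine (minimalMetric_le_of_disc (div_pos hr hc) hf h0 ?_).trans_eq ?_
  · rw [hd, smul_smul, div_mul_cancel₀ _ hc.ne']
  · congr 1; field_simp

theorem minimalMetric_neg_le : minimalMetric D x (-u) ≤ minimalMetric D x u := by
  refine le_iInf fun r ↦ le_iInf fun hr ↦ le_iInf fun ⟨f, hf, h0, hd⟩ ↦ ?_
  refine minimalMetric_le_of_disc hr hf.comp_neg (by simpa using h0) ?_
  rw [fderiv_fun_comp_neg, neg_zero, neg_apply, hd, smul_neg]

/-- Flat discs bound the minimal metric from above. -/
theorem minimalMetric_le_norm_div (hn : 2 ≤ n) {δ : ℝ} (hδ : 0 < δ) (hD : ball x δ ⊆ D) :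
    minimalMetric D x u ≤ ENNReal.ofReal (‖u‖ / δ) := by
  have key : ∀ r : ℝ, 0 < r → r * ‖u‖ ≤ δ → minimalMetric D x u ≤ ENNReal.ofReal (1 / r) := by
    intro r hr hru
    obtain ⟨b, hb, hab⟩ := exists_orthogonal_of_norm_eq hn (r • u)
    have hball : ball x ‖r • u‖ ⊆ D := by
      refine (ball_subset_ball ?_).trans hD
      rwa [norm_smul, Real.norm_of_nonneg hr.le]
    obtain ⟨h1, h2⟩ := isConformalHarmonicDisc_affine hb hab hball (hD (mem_ball_self hδ))
    exact minimalMetric_le_of_disc hr h1 (by simp) h2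
  rcases eq_or_ne u 0 with rfl | hu
  · refine ENNReal.le_of_forall_pos_le_add fun ε hε _ ↦ ?_
    have := key (1 / ε) (by positivity) (by simpa using hδ.le)
    simpa using this
  · have hu' := norm_pos_iff.2 hu
    refine (key (δ / ‖u‖) (by positivity) (by rw [div_mul_cancel₀ _ hu'.ne'])).trans_eq ?_
    rw [one_div_div]

/-- Harnack's inequality bounds the minimal metric from below in terms of a half space
`{L < c}` which contains `D`: along a disc in `D` the function `c - L` is positive and harmonic. -/
theorem enorm_div_le_two_mul_minimalMetric {L : EuclideanSpace ℝ (Fin n) →L[ℝ] ℝ} {c : ℝ}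
    (hL : ∀ w ∈ D, L w < c) (hx : x ∈ D) (u : EuclideanSpace ℝ (Fin n)) :
    ‖L u / (c - L x)‖ₑ ≤ 2 * minimalMetric D x u := by
  have hcx : 0 < c - L x := sub_pos.2 (hL x hx)
  rw [mul_comm, ← ENNReal.div_le_iff_le_mul (by simp) (by simp)]
  refine le_iInf fun r ↦ le_iInf fun hr ↦ le_iInf fun ⟨f, hf, h0, hd⟩ ↦ ?_
  rw [ENNReal.div_le_iff_le_mul (by simp) (by simp)]
  have h0m : (0 : ℂ) ∈ ball (0 : ℂ) 1 := mem_ball_self one_pos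
  have hharm : HarmonicOnNhd (fun z ↦ c - L (f z)) (ball (0 : ℂ) 1) :=
    (harmonicOnNhd_const c).sub (hf.harmonic.comp_CLM L)
  have hS := abs_fderiv_zero_le_two_mul_of_harmonic_pos hharm
    (fun z hz ↦ sub_pos.2 (hL _ (hf.mapsTo hz)))
  have hfd : HasFDerivAt (fun z ↦ c - L (f z)) (-(L.comp (fderiv ℝ f 0))) 0 := by
    have h1 : HasFDerivAt f (fderiv ℝ f 0) 0 :=
      ((hf.harmonic 0 h0m).1.differentiableAt two_ne_zero).hasFDerivAt
    exact (L.hasFDerivAt.comp (0 : ℂ) h1).const_sub c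
  rw [hfd.fderiv] at hS
  simp only [neg_apply, ContinuousLinearMap.comp_apply, hd, map_smul,
    smul_eq_mul, abs_neg, abs_mul, abs_of_pos hr, h0] at hS
  have h2 : ENNReal.ofReal (1 / r) * 2 = ENNReal.ofReal (1 / r * 2) := by
    rw [ENNReal.ofReal_mul (by positivity), ENNReal.ofReal_ofNat]
  rw [← ofReal_norm, h2]
  apply ENNReal.ofReal_le_ofReal
  rw [norm_div, Real.norm_eq_abs, Real.norm_of_nonneg hcx.le, div_le_iff₀ hcx]
  rw [mul_comm] at hS
  rw [← le_div_iff₀ hr] at hS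
  refine hS.trans_eq ?_
  ring

/-! ### Piecewise smooth paths -/

/-- `γ` is piecewise smooth on `[a, b]`: one gets from `a` to `b` by finitely many steps over
nondegenerate intervals on which `γ` is smooth up to the end points. -/
def IsPiecewiseSmoothOn (γ : ℝ → EuclideanSpace ℝ (Fin n)) (a b : ℝ) : Prop :=
  Relation.ReflTransGen (fun s t ↦ s < t ∧ ContDiffOn ℝ ∞ γ (Icc s t)) a b

namespace IsPiecewiseSmoothOn

variable {γ γ' : ℝ → EuclideanSpace ℝ (Fin n)} {a b c : ℝ}

theorem le (h : IsPiecewiseSmoothOn γ a b) : a ≤ b := by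
  induction h with
  | refl => exact le_rfl
  | tail _ h ih => exact ih.trans h.1.le

theorem congr (h : IsPiecewiseSmoothOn γ a b) (heq : EqOn γ' γ (Icc a b)) :
    IsPiecewiseSmoothOn γ' a b := by
  induction h with
  | refl => exact .refl
  | tail h1 h ih =>
    refine .tail (ih (heq.mono (Icc_subset_Icc_right h.1.le))) ⟨h.1, h.2.congr ?_⟩
    exact heq.mono (Icc_subset_Icc_left (IsPiecewiseSmoothOn.le h1))

theorem comp_affine {m q : ℝ} (hm : 0 < m) (h : IsPiecewiseSmoothOn γ (m * a + q) (m * b + q)) :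
    IsPiecewiseSmoothOn (fun t ↦ γ (m * t + q)) a b := by
  have := h.lift (p := fun s t ↦ s < t ∧ ContDiffOn ℝ ∞ (fun t ↦ γ (m * t + q)) (Icc s t))
    (fun s ↦ (s - q) / m) fun s t hst ↦ by
      refine ⟨div_lt_div_of_pos_right (by linarith [hst.1]) hm,
        hst.2.comp (by fun_prop) fun w hw ↦ ?_⟩
      have h1 := (div_le_iff₀ hm).1 hw.1
      have h2 := (le_div_iff₀ hm).1 hw.2
      constructor <;> linarith
  rw [Function.onFun_apply] at this
  simpa [hm.ne', IsPiecewiseSmoothOn] using this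

theorem comp_one_sub (h : IsPiecewiseSmoothOn γ 0 1) :
    IsPiecewiseSmoothOn (fun t ↦ γ (1 - t)) 0 1 := by
  have := (Relation.reflTransGen_swap.2 h).lift
    (p := fun s t ↦ s < t ∧ ContDiffOn ℝ ∞ (fun t ↦ γ (1 - t)) (Icc s t))
    (fun s ↦ 1 - s) fun s t hst ↦ by
      refine ⟨by have := hst.1; linarith, hst.2.comp (by fun_prop) fun w hw ↦ ?_⟩
      have h1 := hw.1
      have h2 := hw.2
      constructor <;> linarith
  rw [Function.onFun_apply] at this
  simpa [IsPiecewiseSmoothOn] using this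

theorem of_partition {k : ℕ} {t : Fin (k + 1) → ℝ} (ht : StrictMono t)
    (h : ∀ i : Fin k, ContDiffOn ℝ ∞ γ (Icc (t i.castSucc) (t i.succ))) :
    IsPiecewiseSmoothOn γ (t 0) (t (Fin.last k)) := by
  suffices ∀ i : Fin (k + 1), IsPiecewiseSmoothOn γ (t 0) (t i) from this _
  intro i
  induction i using Fin.induction with
  | zero => exact .refl
  | succ i ih => exact .tail ih ⟨ht i.castSucc_lt_succ, h i⟩

theorem exists_partition (h : IsPiecewiseSmoothOn γ a b) :
    ∃ (k : ℕ) (t : Fin (k + 1) → ℝ), StrictMono t ∧ t 0 = a ∧ t (Fin.last k) = b ∧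
      ∀ i : Fin k, ContDiffOn ℝ ∞ γ (Icc (t i.castSucc) (t i.succ)) := by
  induction h with
  | refl => exact ⟨0, fun _ ↦ a, fun i j hij ↦ by omega, rfl, rfl, fun i ↦ i.elim0⟩
  | @tail b c _ h ih =>
    obtain ⟨k, t, ht, h0, h1, hi⟩ := ih
    refine ⟨k + 1, Fin.snoc t c, ?_, ?_, by simp, fun i ↦ ?_⟩
    · rw [Fin.strictMono_iff_lt_succ]
      intro i
      induction i using Fin.lastCases with
      | last => simpa [h1] using h.1
      | cast i =>
        rw [← Fin.castSucc_succ, Fin.snoc_castSucc, Fin.snoc_castSucc]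
        exact ht i.castSucc_lt_succ
    · rw [← h0, ← Fin.castSucc_zero, Fin.snoc_castSucc]
    · induction i using Fin.lastCases with
      | last => simpa [h1] using h.2
      | cast i =>
        rw [← Fin.castSucc_succ, Fin.snoc_castSucc, Fin.snoc_castSucc]
        exact hi i

/-- A fundamental theorem of calculus estimate, summed over the pieces. -/
theorem enorm_sub_le_lintegral (h : IsPiecewiseSmoothOn γ a b) {φ : ℝ → ℝ} {w : ℝ → ℝ≥0∞}
    (hφ : ∀ s t, a ≤ s → s < t → t ≤ b → ContDiffOn ℝ ∞ γ (Icc s t) →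
      ‖φ t - φ s‖ₑ ≤ ∫⁻ τ in Icc s t, w τ) :
    ‖φ b - φ a‖ₑ ≤ ∫⁻ τ in Icc a b, w τ := by
  induction h with
  | refl => simp
  | @tail b c h1 h ih =>
    have hab : a ≤ b := IsPiecewiseSmoothOn.le h1
    calc ‖φ c - φ a‖ₑ = ‖(φ b - φ a) + (φ c - φ b)‖ₑ := by congr 1; ring
      _ ≤ ‖φ b - φ a‖ₑ + ‖φ c - φ b‖ₑ := enorm_add_le _ _
      _ ≤ (∫⁻ τ in Icc a b, w τ) + ∫⁻ τ in Icc b c, w τ :=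
        add_le_add (ih fun s t hs hst ht ↦ hφ s t hs hst (ht.trans h.1.le))
          (hφ b c hab h.1 le_rfl h.2)
      _ = (∫⁻ τ in Icc a b, w τ) + ∫⁻ τ in Ioc b c, w τ := by
        rw [restrict_Ioc_eq_restrict_Icc]
      _ = ∫⁻ τ in Icc a c, w τ := by
        rw [← Icc_union_Ioc_eq_Icc hab h.1.le, lintegral_union measurableSet_Ioc]
        exact Set.disjoint_left.2 fun τ h1 h2 ↦ absurd h1.2 (not_le.2 h2.1)

end IsPiecewiseSmoothOn

theorem IsPiecewiseSmoothPath.isPiecewiseSmoothOn {γ : ℝ → EuclideanSpace ℝ (Fin n)}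
    (h : IsPiecewiseSmoothPath D x y γ) : IsPiecewiseSmoothOn γ 0 1 := by
  obtain ⟨k, t, ht, h0, h1, hi⟩ := h.piecewise
  rw [← h0, ← h1]
  exact .of_partition ht hi

/-! ### The minimal pseudodistance -/

theorem minimalDistance_comm_le : minimalDistance D x y ≤ minimalDistance D y x := by
  refine le_iInf fun γ ↦ le_iInf fun hγ ↦ ?_
  have hmaps : MapsTo (fun t : ℝ ↦ 1 - t) (Icc 0 1) (Icc 0 1) := fun t ht ↦
    ⟨by linarith [ht.2], by linarith [ht.1]⟩
  refine iInf_le_of_le (fun t ↦ γ (1 - t)) (iInf_le_of_le ?_ ?_)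
  · exact ⟨hγ.mapsTo.comp hmaps, hγ.continuousOn.comp (by fun_prop) hmaps, by simp [hγ.target],
      by simp [hγ.source], hγ.isPiecewiseSmoothOn.comp_one_sub.exists_partition⟩
  · have himg : (fun t : ℝ ↦ 1 - t) '' Icc 0 1 = Icc 0 1 := by simp
    conv_rhs => rw [← himg]
    rw [lintegral_image_eq_lintegral_abs_deriv_mul measurableSet_Icc
      (fun t _ ↦ ((hasDerivAt_id' t).const_sub 1).hasDerivWithinAt) (sub_right_injective.injOn)]
    refine lintegral_mono fun t ↦ ?_
    simp only [deriv_comp_const_sub, abs_neg, abs_one, ENNReal.ofReal_one, one_mul]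
    exact minimalMetric_neg_le

theorem lintegral_minimalMetric_comp_affine_le {γ : ℝ → EuclideanSpace ℝ (Fin n)} {m q a b : ℝ}
    (hm : 0 < m) :
    ∫⁻ t in Icc a b, minimalMetric D (γ (m * t + q)) (deriv (fun t ↦ γ (m * t + q)) t) ≤
      ∫⁻ t in Icc (m * a + q) (m * b + q), minimalMetric D (γ t) (deriv γ t) := by
  rw [← image_affine_Icc' hm, lintegral_image_eq_lintegral_abs_deriv_mul measurableSet_Icc
    (fun t _ ↦ (((hasDerivAt_id' t).const_mul m).add_const q).hasDerivWithinAt)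
    (fun s _ t _ hst ↦ by simpa [hm.ne'] using hst)]
  refine lintegral_mono fun t ↦ ?_
  have : deriv (fun t ↦ γ (m * t + q)) t = m • deriv γ (m * t + q) := by
    rw [deriv_comp_mul_left m (fun s ↦ γ (s + q)) t, deriv_comp_add_const]
  simp only [this, mul_one, abs_of_pos hm]
  exact minimalMetric_smul_le hm

theorem minimalDistance_triangle :
    minimalDistance D x z ≤ minimalDistance D x y + minimalDistance D y z := by
  conv_rhs => rw [minimalDistance, minimalDistance]
  simp only [ENNReal.iInf_add, ENNReal.add_iInf]
  refine le_iInf fun γ₂ ↦ le_iInf fun h₂ ↦ le_iInf fun γ₁ ↦ le_iInf fun h₁ ↦ ?_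
  set γ : ℝ → EuclideanSpace ℝ (Fin n) :=
    fun t ↦ if t ≤ 1 / 2 then γ₁ (2 * t + 0) else γ₂ (2 * t + -1) with hγ
  have e₁ : EqOn γ (fun t ↦ γ₁ (2 * t + 0)) (Icc 0 (1 / 2)) := fun t ht ↦ if_pos ht.2
  have e₂ : EqOn γ (fun t ↦ γ₂ (2 * t + -1)) (Icc (1 / 2) 1) := fun t ht ↦ by
    rcases ht.1.eq_or_lt with rfl | h
    · norm_num [hγ, h₁.target, h₂.source]
    · exact if_neg (not_le.2 h)
  have m₁ : MapsTo (fun t : ℝ ↦ 2 * t + 0) (Icc 0 (1 / 2)) (Icc 0 1) := fun t ht ↦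
    ⟨by linarith [ht.1], by linarith [ht.2]⟩
  have m₂ : MapsTo (fun t : ℝ ↦ 2 * t + -1) (Icc (1 / 2) 1) (Icc 0 1) := fun t ht ↦
    ⟨by linarith [ht.1], by linarith [ht.2]⟩
  have hunion : Icc (0 : ℝ) (1 / 2) ∪ Icc (1 / 2) 1 = Icc 0 1 :=
    Icc_union_Icc_eq_Icc (by norm_num) (by norm_num)
  have s₁ : IsPiecewiseSmoothOn (fun t ↦ γ₁ (2 * t + 0)) 0 (1 / 2) :=
    .comp_affine two_pos (by simpa using h₁.isPiecewiseSmoothOn)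
  have s₂ : IsPiecewiseSmoothOn (fun t ↦ γ₂ (2 * t + -1)) (1 / 2) 1 := by
    refine .comp_affine two_pos ?_
    have := h₂.isPiecewiseSmoothOn
    norm_num
    exact this
  have hpath : IsPiecewiseSmoothPath D x z γ := by
    refine ⟨?_, ?_, ?_, ?_, ?_⟩
    · rw [← hunion]
      exact ((h₁.mapsTo.comp m₁).congr e₁.symm).union_union ((h₂.mapsTo.comp m₂).congr e₂.symm)
        |>.mono_right (union_self D).subset
    · rw [← hunion]
      exact ((h₁.continuousOn.comp (by fun_prop) m₁).congr e₁).union_of_isClosed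
        ((h₂.continuousOn.comp (by fun_prop) m₂).congr e₂) isClosed_Icc isClosed_Icc
    · simp [hγ, h₁.source]
    · norm_num [hγ, h₂.target]
    · exact IsPiecewiseSmoothOn.exists_partition (.trans (s₁.congr e₁) (s₂.congr e₂))
  refine iInf_le_of_le γ (iInf_le_of_le hpath ?_)
  have hsplit : ∀ w : ℝ → ℝ≥0∞, ∫⁻ t in Icc (0 : ℝ) 1, w t ≤
      (∫⁻ t in Icc (0 : ℝ) (1 / 2), w t) + ∫⁻ t in Icc (1 / 2 : ℝ) 1, w t := fun w ↦ by
    rw [← hunion]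
    exact lintegral_union_le _ _ _
  refine (hsplit _).trans (add_le_add ?_ ?_)
  · refine le_trans (le_of_eq ?_) ((lintegral_minimalMetric_comp_affine_le (D := D) (γ := γ₁)
      (q := 0) (a := 0) (b := 1 / 2) two_pos).trans_eq (by norm_num))
    rw [← restrict_Ioo_eq_restrict_Icc]
    refine setLIntegral_congr_fun measurableSet_Ioo fun t ht ↦ ?_
    have : γ =ᶠ[𝓝 t] fun t ↦ γ₁ (2 * t + 0) :=
      e₁.eventuallyEq_of_mem (Icc_mem_nhds ht.1 ht.2)
    simp only [this.deriv_eq, this.eq_of_nhds]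
  · refine le_trans (le_of_eq ?_) ((lintegral_minimalMetric_comp_affine_le (D := D) (γ := γ₂)
      (q := -1) (a := 1 / 2) (b := 1) two_pos).trans_eq (by norm_num))
    rw [← restrict_Ioo_eq_restrict_Icc]
    refine setLIntegral_congr_fun measurableSet_Ioo fun t ht ↦ ?_
    have : γ =ᶠ[𝓝 t] fun t ↦ γ₂ (2 * t + -1) :=
      e₂.eventuallyEq_of_mem (Icc_mem_nhds ht.1 ht.2)
    simp only [this.deriv_eq, this.eq_of_nhds]

/-- Comparison with the Euclidean length of the segment from `x` to `y`. -/
theorem minimalDistance_le_norm_div (hn : 2 ≤ n) {δ : ℝ} (hδ : 0 < δ)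
    (hD : ∀ w ∈ segment ℝ x y, ball w δ ⊆ D) :
    minimalDistance D x y ≤ ENNReal.ofReal (‖y - x‖ / δ) := by
  set γ : ℝ → EuclideanSpace ℝ (Fin n) := fun t ↦ x + t • (y - x) with hγ
  have hseg : MapsTo γ (Icc 0 1) (segment ℝ x y) := fun t ht ↦ by
    rw [segment_eq_image']
    exact ⟨t, ht, rfl⟩
  have hsmooth : ContDiff ℝ ∞ γ := by fun_prop
  have hderiv : ∀ t, deriv γ t = y - x := fun t ↦ by
    have := (((hasDerivAt_id' t).smul_const (y - x)).const_add x).deriv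
    rwa [one_smul] at this
  refine iInf_le_of_le γ (iInf_le_of_le ⟨fun t ht ↦ hD _ (hseg ht) (mem_ball_self hδ),
    hsmooth.continuous.continuousOn, by simp [hγ], by simp [hγ],
    IsPiecewiseSmoothOn.exists_partition (.single ⟨zero_lt_one, hsmooth.contDiffOn⟩)⟩ ?_)
  calc ∫⁻ t in Icc (0 : ℝ) 1, minimalMetric D (γ t) (deriv γ t)
      ≤ ∫⁻ t in Icc (0 : ℝ) 1, ENNReal.ofReal (‖y - x‖ / δ) := by
        refine setLIntegral_mono measurable_const fun t ht ↦ ?_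
        rw [hderiv]
        exact minimalMetric_le_norm_div hn hδ (hD _ (hseg ht))
    _ = ENNReal.ofReal (‖y - x‖ / δ) := by simp

theorem minimalDistance_ne_top (hn : 2 ≤ n) (hD : IsOpen D) (hconv : Convex ℝ D) (hx : x ∈ D)
    (hy : y ∈ D) : minimalDistance D x y ≠ ⊤ := by
  have hcomp : IsCompact (segment ℝ x y) := by
    rw [segment_eq_image_lineMap]
    exact isCompact_Icc.image (by fun_prop)
  obtain ⟨δ, hδ, hsub⟩ := hcomp.exists_thickening_subset_open hD (hconv.segment_subset hx hy)
  refine ne_top_of_le_ne_top ENNReal.ofReal_ne_top (minimalDistance_le_norm_div hn hδ ?_)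
  exact fun w hw ↦ (ball_subset_thickening hw δ).trans hsub

/-- The logarithm of the distance to the boundary of a half space containing `D` is Lipschitz for
the minimal pseudodistance. -/
theorem enorm_log_sub_log_le {L : EuclideanSpace ℝ (Fin n) →L[ℝ] ℝ} {c : ℝ}
    (hL : ∀ w ∈ D, L w < c) :
    ‖Real.log (c - L y) - Real.log (c - L x)‖ₑ ≤ 2 * minimalDistance D x y := by
  rw [mul_comm, ← ENNReal.div_le_iff_le_mul (by simp) (by simp)]
  refine le_iInf fun γ ↦ le_iInf fun hγ ↦ ?_
  rw [ENNReal.div_le_iff_le_mul (by simp) (by simp), mul_comm,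
    ← lintegral_const_mul' _ _ (by simp), ← hγ.source, ← hγ.target]
  have hpos : ∀ τ ∈ Icc (0 : ℝ) 1, 0 < c - L (γ τ) := fun τ hτ ↦
    sub_pos.2 (hL _ (hγ.mapsTo hτ))
  refine hγ.isPiecewiseSmoothOn.enorm_sub_le_lintegral (φ := fun t ↦ Real.log (c - L (γ t)))
    fun s t hs hst ht hsm ↦ ?_
  have hsub : Icc s t ⊆ Icc 0 1 := Icc_subset_Icc hs ht
  have hφ : ContDiffOn ℝ 1 (fun t ↦ Real.log (c - L (γ t))) (Icc s t) := by
    refine ContDiffOn.log ?_ fun τ hτ ↦ (hpos τ (hsub hτ)).ne'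
    exact contDiffOn_const.sub (L.contDiff.comp_contDiffOn (hsm.of_le (by simp)))
  refine (enorm_sub_le_lintegral_deriv_of_contDiffOn_Icc hφ hst.le).trans ?_
  rw [← restrict_Ioo_eq_restrict_Icc]
  refine setLIntegral_mono' measurableSet_Ioo fun τ hτ ↦ ?_
  have hτ01 := hsub (Ioo_subset_Icc_self hτ)
  have hd : HasDerivAt γ (deriv γ τ) τ :=
    ((hsm.contDiffAt (Icc_mem_nhds hτ.1 hτ.2)).differentiableAt (by simp)).hasDerivAt
  have hd' := ((L.hasFDerivAt.comp_hasDerivAt τ hd).const_sub c).log (hpos τ hτ01).ne'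
  have hd'' : deriv (fun t ↦ Real.log (c - L (γ t))) τ = -L (deriv γ τ) / (c - L (γ τ)) :=
    hd'.deriv
  rw [hd'', neg_div, enorm_neg]
  exact enorm_div_le_two_mul_minimalMetric hL (hγ.mapsTo hτ01) _

theorem abs_sub_le_mul_abs_log_sub_log {a b M : ℝ} (ha : 0 < a) (hb : 0 < b) (haM : a ≤ M)
    (hbM : b ≤ M) : |a - b| ≤ M * |Real.log a - Real.log b| := by
  wlog hab : b ≤ a generalizing a b
  · rw [abs_sub_comm, abs_sub_comm (Real.log a)]
    exact this hb ha hbM haM (le_of_not_ge hab)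
  have h1 := Real.log_le_sub_one_of_pos (div_pos hb ha)
  rw [Real.log_div hb.ne' ha.ne'] at h1
  have h2 : (a - b) / a ≤ Real.log a - Real.log b := by
    rw [sub_div, div_self ha.ne']; linarith
  rw [abs_of_nonneg (sub_nonneg.2 hab), abs_of_nonneg (sub_nonneg.2 (Real.log_le_log hb hab))]
  calc a - b ≤ a * (Real.log a - Real.log b) := by rwa [div_le_iff₀' ha] at h2
    _ ≤ _ := by
      gcongr
      exact sub_nonneg.2 (Real.log_le_log hb hab)

/-- On a bounded domain the minimal pseudodistance dominates a multiple of the Euclidean one. -/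
theorem exists_edist_le_mul_minimalDistance (hbdd : Bornology.IsBounded D) :
    ∃ C : ℝ≥0∞, C ≠ 0 ∧ C ≠ ⊤ ∧ ∀ x ∈ D, ∀ y ∈ D, edist x y ≤ C * minimalDistance D x y := by
  obtain ⟨R, hR0, hR⟩ := hbdd.exists_pos_norm_le
  refine ⟨ENNReal.ofReal (2 * R + 1) * 2, by simp; linarith,
    ENNReal.mul_ne_top ENNReal.ofReal_ne_top (by simp), fun x hx y hy ↦ ?_⟩
  rcases eq_or_ne x y with rfl | hxy
  · simp
  have hpos : 0 < ‖x - y‖ := norm_pos_iff.2 (sub_ne_zero.2 hxy)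
  -- The unit vector from `y` to `x` detects the whole distance.
  set L : EuclideanSpace ℝ (Fin n) →L[ℝ] ℝ := innerSL ℝ (‖x - y‖⁻¹ • (x - y)) with hL
  have hLn : ∀ w ∈ D, |L w| ≤ R := fun w hw ↦ by
    have h1 : ‖‖x - y‖⁻¹ • (x - y)‖ = 1 := norm_smul_inv_norm (𝕜 := ℝ) (sub_ne_zero.2 hxy)
    have h2 := abs_real_inner_le_norm (‖x - y‖⁻¹ • (x - y)) w
    rw [h1, one_mul] at h2
    exact h2.trans (hR w hw)
  have hLd : L x - L y = ‖x - y‖ := by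
    rw [← map_sub, hL, innerSL_apply_apply, inner_smul_left, real_inner_self_eq_norm_sq]
    simp
    field_simp
  have hlog := enorm_log_sub_log_le (x := x) (y := y) (L := L) (c := R + 1)
    (fun w hw ↦ by linarith [(abs_le.1 (hLn w hw)).2])
  have hx' := abs_le.1 (hLn x hx)
  have hy' := abs_le.1 (hLn y hy)
  have h3 := abs_sub_le_mul_abs_log_sub_log (a := R + 1 - L y) (b := R + 1 - L x)
    (M := 2 * R + 1) (by linarith) (by linarith) (by linarith) (by linarith)
  rw [sub_sub_sub_cancel_left, hLd, abs_norm] at h3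
  rw [mul_assoc]
  calc edist x y = ENNReal.ofReal ‖x - y‖ := by rw [edist_dist, dist_eq_norm]
    _ ≤ ENNReal.ofReal (2 * R + 1) * ‖Real.log (R + 1 - L y) - Real.log (R + 1 - L x)‖ₑ := by
      rw [← ofReal_norm, ← ENNReal.ofReal_mul (by positivity)]
      exact ENNReal.ofReal_le_ofReal h3
    _ ≤ _ := by gcongr

/-! ### Completeness -/

/-- On a bounded convex domain, a Cauchy sequence for the minimal pseudodistance has a limit: its
Euclidean limit cannot lie on a supporting hyperplane `{L = c}`, since `log (c - L)` would tend
to `-∞` along the sequence. -/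
theorem exists_tendsto_minimalDistance (hn : 2 ≤ n) (hbdd : Bornology.IsBounded D) (hD : IsOpen D)
    (hconv : Convex ℝ D) {s : ℕ → EuclideanSpace ℝ (Fin n)} (hsD : ∀ i, s i ∈ D)
    (hs : ∀ ε > 0, ∃ N, ∀ i ≥ N, ∀ j ≥ N, minimalDistance D (s i) (s j) < ε) :
    ∃ q ∈ D, Tendsto (fun i ↦ minimalDistance D (s i) q) atTop (𝓝 0) := by
  obtain ⟨C, hC0, hCt, hC⟩ := exists_edist_le_mul_minimalDistance hbdd
  have hcauchy : CauchySeq s := by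
    refine EMetric.cauchySeq_iff.2 fun ε hε ↦ ?_
    obtain ⟨N, hN⟩ := hs (ε / C) (ENNReal.div_pos hε.ne' hCt)
    refine ⟨N, fun i hi j hj ↦ (hC _ (hsD i) _ (hsD j)).trans_lt ?_⟩
    have := hN i hi j hj
    rwa [ENNReal.lt_div_iff_mul_lt (.inl hC0) (.inl hCt), mul_comm] at this
  obtain ⟨q, hq⟩ := cauchySeq_tendsto_of_complete hcauchy
  by_cases hqD : q ∈ D
  · refine ⟨q, hqD, ?_⟩
    obtain ⟨ε, hε, hball⟩ := Metric.isOpen_iff.1 hD q hqD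
    have hlim : Tendsto (fun i ↦ ENNReal.ofReal (‖q - s i‖ / (ε / 2))) atTop (𝓝 0) := by
      have : Tendsto (fun i ↦ ‖q - s i‖ / (ε / 2)) atTop (𝓝 (‖q - q‖ / (ε / 2))) :=
        (tendsto_const_nhds.sub hq).norm.div_const _
      simpa using ENNReal.tendsto_ofReal this
    refine tendsto_of_tendsto_of_tendsto_of_le_of_le' tendsto_const_nhds hlim
      (.of_forall fun _ ↦ zero_le) ?_
    filter_upwards [hq.eventually (ball_mem_nhds q (half_pos hε))] with i hi
    refine minimalDistance_le_norm_div hn (half_pos hε) fun w hw ↦ ?_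
    have hw' : dist w q < ε / 2 :=
      (convex_ball q (ε / 2)).segment_subset hi (mem_ball_self (half_pos hε)) hw
    exact (ball_subset_ball' (by linarith)).trans hball
  · obtain ⟨L, hL⟩ := geometric_hahn_banach_open_point hconv hD hqD
    obtain ⟨N, hN⟩ := hs 1 one_pos
    have hlim : Tendsto (fun i ↦ L q - L (s i)) atTop (𝓝[>] 0) := by
      refine tendsto_nhdsWithin_iff.2 ⟨?_, .of_forall fun i ↦ sub_pos.2 (hL _ (hsD i))⟩
      simpa using (tendsto_const_nhds (x := L q)).sub ((L.continuous.tendsto q).comp hq)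
    have hlog := Real.tendsto_log_nhdsGT_zero.comp hlim
    obtain ⟨i, hi, hiN⟩ := ((hlog.eventually_lt_atBot (Real.log (L q - L (s N)) - 2)).and
      (eventually_ge_atTop N)).exists
    have h1 : ‖Real.log (L q - L (s i)) - Real.log (L q - L (s N))‖ₑ ≤ ENNReal.ofReal 2 := by
      refine (enorm_log_sub_log_le hL).trans ?_
      simpa using mul_le_mul_right (hN N le_rfl i hiN).le 2
    rw [← ofReal_norm, ENNReal.ofReal_le_ofReal_iff zero_le_two, Real.norm_eq_abs] at h1
    have := (abs_le.1 h1).1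
    simp only [Function.comp_apply] at hi
    linarith

/-- An extended distance function that is finite and for which Cauchy sequences converge is the
distance of a complete metric space. -/
theorem exists_completeSpace_of_edist {α : Type*} (ρ : α → α → ℝ≥0∞) (hself : ∀ a, ρ a a = 0)
    (hcomm : ∀ a b, ρ a b = ρ b a) (htri : ∀ a b c, ρ a c ≤ ρ a b + ρ b c)
    (heq : ∀ a b, ρ a b = 0 → a = b) (hfin : ∀ a b, ρ a b ≠ ⊤)
    (hlim : ∀ s : ℕ → α, (∀ ε > 0, ∃ N, ∀ i ≥ N, ∀ j ≥ N, ρ (s i) (s j) < ε) →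
      ∃ a, Tendsto (fun i ↦ ρ (s i) a) atTop (𝓝 0)) :
    ∃ m : MetricSpace α, (∀ a b, m.edist a b = ρ a b) ∧
      @CompleteSpace α m.toPseudoMetricSpace.toUniformSpace := by
  let e : EMetricSpace α :=
    { edist := ρ
      edist_self := hself
      edist_comm := hcomm
      edist_triangle := htri
      eq_of_edist_eq_zero := heq _ _ }
  let m : MetricSpace α := EMetricSpace.toMetricSpace hfin
  refine ⟨m, fun _ _ ↦ rfl, Metric.complete_of_cauchySeq_tendsto fun s hs ↦ ?_⟩
  obtain ⟨a, ha⟩ := hlim s fun ε hε ↦ EMetric.cauchySeq_iff.1 hs ε hε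
  exact ⟨a, tendsto_iff_edist_tendsto_0.2 ha⟩

theorem theorem6p9 (n : ℕ) (hn : 3 ≤ n) (D : Set (EuclideanSpace ℝ (Fin n)))
    (hbdd : Bornology.IsBounded D) (hD : IsStronglyConvexC2Domain D) :
    IsCompleteHyperbolic D := by
  have hn2 : 2 ≤ n := by omega
  refine exists_completeSpace_of_edist
    (fun x y : D ↦ minimalDistance D (x : EuclideanSpace ℝ (Fin n)) y) (fun x ↦ ?_)
    (fun _ _ ↦ le_antisymm minimalDistance_comm_le minimalDistance_comm_le)
    (fun _ _ _ ↦ minimalDistance_triangle) (fun x y hxy ↦ ?_)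
    (fun x y ↦ minimalDistance_ne_top hn2 hD.isOpen hD.convex x.2 y.2) (fun s hs ↦ ?_)
  · obtain ⟨δ, hδ, hball⟩ := Metric.isOpen_iff.1 hD.isOpen x x.2
    have := minimalDistance_le_norm_div (x := (x : EuclideanSpace ℝ (Fin n))) (y := x) hn2 hδ
      (by simpa using hball)
    simpa using this
  · obtain ⟨C, -, -, hC⟩ := exists_edist_le_mul_minimalDistance hbdd
    have := hC x x.2 y y.2
    simp only [hxy, mul_zero, nonpos_iff_eq_zero, edist_eq_zero] at this
    exact Subtype.ext this
  · obtain ⟨q, hq, hlim⟩ := exists_tendsto_minimalDistance hn2 hbdd hD.isOpen hD.convex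
      (fun i ↦ (s i).2) hs
    exact ⟨⟨q, hq⟩, hlim⟩
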